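/- Let $D$ be an integral domain with quotient field $K$, and let $X$ be an indeterminate over $K$. For nonzero $D$-submodules $E, F$ of $K$ put $(D:E)=\{z\in K \mid zE\subseteq D\}$ and $E^{v}=(D:(D:E))$, let $E^{t}$ be the union of all $F^{v}$ with $F$ a nonzero finitely generated $D$-submodule of $E$, and let $$E^{w}=\bigcap\{E D_M \mid M \text{ a maximal } t\text{-ideal of } D\},$$ where a maximal $t$-ideal is a maximal element of the set of proper nonzero ideals $I$ of $D$ with $I^{t}=I$ (these are prime), and $E^{w}=K$ if there are none. The domain $D$ is a Prüfer $v$-multiplication domain (P$v$MD) if $(I\,(D:I))^{t}=D$ for every nonzero finitely generated ideal $I$ of $D$. For $0\neq h\in K[X]$ let $c_D(h)$ be the $D$-submodule of $K$ generated by the coefficients of $h$. Then $D$ is a P$v$MD if and only if $c_D(fg)^{w}=(c_D(f)\,c_D(g))^{w}$ for all nonzero $f,g\in K[X]$. -/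

import Mathlib

namespace Semistar

section Operations

variable {D : Type*} [CommRing D] {K : Type*} [Field K] [Algebra D K]

/-! Operations on the nonzero `D`-submodules of the quotient field `K` are represented by maps
`Submodule D K → Submodule D K`; their value at the zero submodule plays no role. -/

/-- The `v`-operation `E ↦ (D : (D : E))`. Here `1 : Submodule D K` is the image of `D` in `K`
and `1 / E = {z | z E ⊆ D}`. -/
noncomputable def vOp (E : Submodule D K) : Submodule D K :=
  1 / (1 / E)

/-- The operation of finite type associated to `s`: the union of all `F^s`, for `F` a nonzero
finitely generated submodule of `E`. The supremum is directed for monotone `s`, so it is a union: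
see `mem_finType_iff`. -/
noncomputable def finType (s : Submodule D K → Submodule D K) (E : Submodule D K) :
    Submodule D K :=
  ⨆ F : {F : Submodule D K // F.FG ∧ F ≠ ⊥ ∧ F ≤ E}, s F

theorem mem_finType_iff {s : Submodule D K → Submodule D K} (hs : Monotone s)
    {E : Submodule D K} (hE : E ≠ ⊥) {x : K} :
    x ∈ finType s E ↔ ∃ F : Submodule D K, F.FG ∧ F ≠ ⊥ ∧ F ≤ E ∧ x ∈ s F := by
  obtain ⟨e, heE, he⟩ := Submodule.exists_mem_ne_zero_of_ne_bot hE
  have hne : Nonempty {F : Submodule D K // F.FG ∧ F ≠ ⊥ ∧ F ≤ E} :=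
    ⟨⟨Submodule.span D {e}, Submodule.fg_span_singleton e, by simpa using he, by simpa using heE⟩⟩
  have hdir : Directed (· ≤ ·)
      (fun F : {F : Submodule D K // F.FG ∧ F ≠ ⊥ ∧ F ≤ E} => s F) := by
    intro F G
    refine ⟨⟨F.1 ⊔ G.1, F.2.1.sup G.2.1, ?_, sup_le F.2.2.2 G.2.2.2⟩, hs le_sup_left,
      hs le_sup_right⟩
    exact fun h => F.2.2.1 (le_bot_iff.mp (le_sup_left.trans h.le))
  unfold finType
  rw [Submodule.mem_iSup_of_directed _ hdir]
  constructor
  · rintro ⟨F, hF⟩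
    exact ⟨F.1, F.2.1, F.2.2.1, F.2.2.2, hF⟩
  · rintro ⟨F, h1, h2, h3, hF⟩
    exact ⟨⟨F, h1, h2, h3⟩, hF⟩

/-- A nonzero ideal `I` of `D` is a quasi-`s`-ideal if `I^s ∩ D = I`. -/
def IsQuasiIdeal (s : Submodule D K → Submodule D K) (I : Ideal D) : Prop :=
  I ≠ ⊥ ∧ (s (IsLocalization.coeSubmodule K I)).comap (Algebra.linearMap D K) = I

/-- A quasi-`s`-maximal ideal: maximal among the proper quasi-`s`-ideals of `D`. -/
def IsQuasiMaximal (s : Submodule D K → Submodule D K) (M : Ideal D) : Prop :=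
  Maximal (fun I : Ideal D => I ≠ ⊤ ∧ IsQuasiIdeal s I) M

/-- The set of quasi-`s`-maximal ideals, as a set of primes. For `s` of finite type every
quasi-`s`-maximal ideal is prime: see `IsQuasiMaximal.isPrime` for the case `s = t`. -/
def quasiMax (s : Submodule D K → Submodule D K) : Set (PrimeSpectrum D) :=
  {P | IsQuasiMaximal s P.asIdeal}

/-- The localization `D_P` as a `D`-submodule of the quotient field. -/
noncomputable def localizationAt [IsDomain D] (K : Type*) [Field K] [Algebra D K] [IsFractionRing D K]
    (P : PrimeSpectrum D) : Submodule D K :=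
  Subalgebra.toSubmodule (Localization.subalgebra.ofField K P.asIdeal.primeCompl
    P.asIdeal.primeCompl_le_nonZeroDivisors)

/-- The spectral operation `E ↦ ⋂ {E D_P | P ∈ Δ}`. For empty `Δ` this is `E ↦ K`. -/
noncomputable def spectral [IsDomain D] [IsFractionRing D K] (Δ : Set (PrimeSpectrum D))
    (E : Submodule D K) : Submodule D K :=
  ⨅ P ∈ Δ, E * localizationAt K P

/-- The stable operation of finite type associated to `s`: the spectral operation given by the
quasi-maximal ideals of the operation of finite type associated to `s`. -/
noncomputable def stable [IsDomain D] [IsFractionRing D K] (s : Submodule D K → Submodule D K) :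
    Submodule D K → Submodule D K :=
  spectral (quasiMax (finType s))

/-- The `t`-operation, the operation of finite type associated to `v`. -/
noncomputable def tOp : Submodule D K → Submodule D K :=
  finType vOp

/-- The `w`-operation, the stable operation of finite type associated to `v`. -/
noncomputable def wOp [IsDomain D] [IsFractionRing D K] : Submodule D K → Submodule D K :=
  stable vOp

/-- A nonzero ideal `I` is `s`-invertible if `(I I⁻¹)^s = D^s`, where `I⁻¹ = (D : I)`. -/
def IsInvertibleFor (s : Submodule D K → Submodule D K) (I : Ideal D) : Prop :=
  s (IsLocalization.coeSubmodule K I * (1 / IsLocalization.coeSubmodule K I)) = s 1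

/-- `D` is a Prüfer `s`-multiplication domain: every nonzero finitely generated ideal of `D` is
invertible for the operation of finite type associated to `s`. -/
def IsPruferMultiplicationDomain (s : Submodule D K → Submodule D K) : Prop :=
  ∀ I : Ideal D, I ≠ ⊥ → I.FG → IsInvertibleFor (finType s) I

/-- The content `c_D(h)`: the `D`-submodule of `K` generated by the coefficients of `h`. -/
def content (D : Type*) [CommRing D] {K : Type*} [Field K] [Algebra D K]
    (h : Polynomial K) : Submodule D K :=
  Submodule.span D (Set.range h.coeff)

end Operations

section Basic

variable {D : Type*} [CommRing D] {K : Type*} [Field K] [Algebra D K]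

theorem one_div_anti {E F : Submodule D K} (h : E ≤ F) : (1 : Submodule D K) / F ≤ 1 / E := by
  intro x hx
  rw [Submodule.mem_div_iff_forall_mul_mem] at hx ⊢
  exact fun y hy => hx y (h hy)

theorem vOp_mono : Monotone (vOp : Submodule D K → Submodule D K) :=
  fun _ _ h => one_div_anti (one_div_anti h)

theorem le_vOp (E : Submodule D K) : E ≤ vOp E := by
  intro x hx
  rw [vOp, Submodule.mem_div_iff_forall_mul_mem]
  intro y hy
  rw [mul_comm]
  exact (Submodule.mem_div_iff_forall_mul_mem.mp hy) x hx

theorem vOp_vOp (E : Submodule D K) : vOp (vOp E) = vOp E :=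
  le_antisymm (one_div_anti (le_vOp (1 / E))) (le_vOp _)

theorem le_tOp (E : Submodule D K) : E ≤ tOp E := by
  intro x hx
  by_cases hx0 : x = 0
  · simp [hx0]
  have hE : E ≠ ⊥ := fun h => hx0 (by simpa [h] using hx)
  refine (mem_finType_iff vOp_mono hE).mpr ⟨Submodule.span D {x},
    Submodule.fg_span_singleton x, by simpa using hx0, by simpa using hx, ?_⟩
  exact le_vOp _ (Submodule.mem_span_singleton_self x)

theorem tOp_mono : Monotone (tOp : Submodule D K → Submodule D K) := by
  intro E F h
  exact iSup_le fun G => le_iSup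
    (fun G : {G : Submodule D K // G.FG ∧ G ≠ ⊥ ∧ G ≤ F} => vOp (G : Submodule D K))
    ⟨G.1, G.2.1, G.2.2.1, G.2.2.2.trans h⟩

theorem tOp_tOp {E : Submodule D K} (hE : E ≠ ⊥) : tOp (tOp E) = tOp E := by
  refine le_antisymm ?_ (le_tOp _)
  refine iSup_le ?_
  rintro ⟨G, hG, -, hGE⟩
  obtain ⟨S, rfl⟩ := hG
  have key : ∀ S : Finset K, (S : Set K) ⊆ tOp E →
      ∃ F : Submodule D K, F.FG ∧ F ≠ ⊥ ∧ F ≤ E ∧ (S : Set K) ⊆ vOp F := by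
    classical
    intro S
    induction S using Finset.induction_on with
    | empty =>
      intro _
      obtain ⟨F, h1, h2, h3, -⟩ :=
        (mem_finType_iff vOp_mono hE).mp (Submodule.zero_mem (finType vOp E))
      exact ⟨F, h1, h2, h3, by simp⟩
    | insert a S _ ih =>
      intro h
      rw [Finset.coe_insert, Set.insert_subset_iff] at h
      obtain ⟨F, h1, h2, h3, h4⟩ := ih h.2
      obtain ⟨F', h1', -, h3', h4'⟩ := (mem_finType_iff vOp_mono hE).mp h.1
      refine ⟨F ⊔ F', h1.sup h1', fun h => h2 (le_bot_iff.mp (h ▸ le_sup_left)),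
        sup_le h3 h3', ?_⟩
      rw [Finset.coe_insert, Set.insert_subset_iff]
      exact ⟨vOp_mono le_sup_right h4', h4.trans (vOp_mono le_sup_left)⟩
  obtain ⟨F, h1, h2, h3, h4⟩ := key S (Submodule.span_le.mp hGE)
  intro x hx
  refine (mem_finType_iff vOp_mono hE).mpr ⟨F, h1, h2, h3, ?_⟩
  rw [← vOp_vOp F]
  exact vOp_mono (Submodule.span_le.mpr h4) hx

/-- Quasi-`t`-maximal ideals are prime. -/
theorem IsQuasiMaximal.isPrime [IsDomain D] [IsFractionRing D K] {M : Ideal D}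
    (hM : IsQuasiMaximal (tOp : Submodule D K → Submodule D K) M) : M.IsPrime := by
  have hinj := IsFractionRing.injective D K
  refine ⟨hM.prop.1, ?_⟩
  intro a b hab
  by_contra! hcon
  obtain ⟨ha, hb⟩ := hcon
  have hb0 : b ≠ 0 := fun h => hb (h ▸ M.zero_mem)
  set N : Ideal D := M ⊔ Ideal.span {a} with hN
  have hMN : M ≤ N := le_sup_left
  have haN : a ∈ N := (le_sup_right : _ ≤ N) (Ideal.mem_span_singleton_self a)
  have hcoe : ∀ {I : Ideal D}, I ≠ ⊥ → IsLocalization.coeSubmodule K I ≠ ⊥ := by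
    intro I hI h
    obtain ⟨x, hx, hx0⟩ := Submodule.exists_mem_ne_zero_of_ne_bot hI
    have : algebraMap D K x ∈ IsLocalization.coeSubmodule K I := ⟨x, hx, rfl⟩
    rw [h, Submodule.mem_bot] at this
    exact hx0 (hinj (by simpa using this))
  have hN0 : N ≠ ⊥ := fun h => hM.prop.2.1 (le_bot_iff.mp (h ▸ hMN))
  set J : Ideal D := (tOp (IsLocalization.coeSubmodule K N)).comap (Algebra.linearMap D K) with hJ
  have hNJ : N ≤ J := fun x hx => Submodule.mem_comap.mpr
    (le_tOp _ (Submodule.mem_map_of_mem hx))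
  have hJ0 : J ≠ ⊥ := fun h => hN0 (le_bot_iff.mp (h ▸ hNJ))
  have hJq : IsQuasiIdeal (tOp : Submodule D K → Submodule D K) J := by
    refine ⟨hJ0, le_antisymm ?_ fun x hx => Submodule.mem_comap.mpr
      (le_tOp _ (Submodule.mem_map_of_mem hx))⟩
    refine Submodule.comap_mono ?_
    rw [← tOp_tOp (hcoe hN0)]
    refine tOp_mono ?_
    rintro _ ⟨x, hx, rfl⟩
    exact hx
  have hJt : J = ⊤ := by
    by_contra hne
    exact ha (hM.le_of_ge ⟨hne, hJq⟩ (hMN.trans hNJ) (hNJ haN))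
  have h1 : (1 : K) ∈ tOp (IsLocalization.coeSubmodule K N) := by
    have : (1 : D) ∈ J := hJt ▸ Submodule.mem_top
    simpa [hJ] using this
  obtain ⟨F, hF, hF0, hFN, h1F⟩ := (mem_finType_iff vOp_mono (hcoe hN0)).mp h1
  have hbK : algebraMap D K b ≠ 0 := fun h => hb0 (hinj (by simpa using h))
  apply hb
  have hq := hM.prop.2.2
  rw [← hq, Submodule.mem_comap]
  refine (mem_finType_iff vOp_mono (hcoe hM.prop.2.1)).mpr
    ⟨F.map (LinearMap.mulLeft D (algebraMap D K b)), hF.map _, ?_, ?_, ?_⟩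
  · obtain ⟨x, hx, hx0⟩ := Submodule.exists_mem_ne_zero_of_ne_bot hF0
    intro h
    have : algebraMap D K b * x ∈ F.map (LinearMap.mulLeft D (algebraMap D K b)) :=
      ⟨x, hx, rfl⟩
    rw [h, Submodule.mem_bot] at this
    exact mul_ne_zero hbK hx0 this
  · rintro _ ⟨x, hx, rfl⟩
    obtain ⟨n, hn, rfl⟩ := (Submodule.mem_map.mp (hFN hx))
    obtain ⟨m, hm, c, hc, rfl⟩ := Submodule.mem_sup.mp hn
    obtain ⟨r, rfl⟩ := Ideal.mem_span_singleton.mp hc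
    refine ⟨b * (m + a * r), ?_, by simp⟩
    have : b * (m + a * r) = b * m + r * (a * b) := by ring
    show b * (m + a * r) ∈ M
    rw [this]
    exact M.add_mem (M.mul_mem_left _ hm) (M.mul_mem_left _ hab)
  · rw [vOp, Submodule.mem_div_iff_forall_mul_mem] at h1F ⊢
    intro z hz
    rw [Submodule.mem_div_iff_forall_mul_mem] at hz
    have : z * algebraMap D K b ∈ (1 : Submodule D K) / F := by
      rw [Submodule.mem_div_iff_forall_mul_mem]
      intro y hy
      have := hz _ ⟨y, hy, rfl⟩
      simpa [mul_assoc] using this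
    simpa [mul_comm] using h1F _ this

end Basic

end Semistar

namespace Semistar

open Polynomial

/-! ### Contents of polynomials -/

section Content

variable {D : Type*} [CommRing D] {K : Type*} [Field K] [Algebra D K]

/-! Both conditions are equivalent to a third: `D_P` is a valuation ring for every maximal `t`-ideal
`P`. Equality of `w`-closures can be tested after extension to each such `D_P` (`spectral_eq_iff`),
and `c(fg) ⊆ c(f)c(g)` always holds, so the content formula amounts to `c(f)c(g) ⊆ c(fg)D_P` for all
these `P`. Over a valuation ring this is Gauss' lemma: among the coefficients of maximal value take
the first one in `f` and the first one in `g`; their product cannot be cancelled in `fg`.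
Conversely, two test products recover the valuation property
(`isValuationAt_of_content_mul_content_le`): `(xX+1)(xX-1)` gives `x ∈ (x², 1)D_P`, and a quadratic
with roots `y`, `1-y` then puts a suitable `y` in the local ring `D_P`, where `y` or `1-y` is a
unit. The link with P`v`MDs rests on `tOp_eq_tOp_one`: a nonzero integral submodule has trivial
`t`-closure once no maximal `t`-ideal contains it. Hence `t`-invertibility of a finitely generated
ideal is invertibility at each `P`, which in `D_P` means being principal. -/

theorem coeff_mem_content (f : K[X]) (n : ℕ) : f.coeff n ∈ content D f :=
  Submodule.subset_span ⟨n, rfl⟩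

theorem content_le {f : K[X]} {E : Submodule D K} : content D f ≤ E ↔ ∀ n, f.coeff n ∈ E := by
  rw [content, Submodule.span_le, Set.range_subset_iff]
  rfl

theorem content_mul_le (f g : K[X]) : content D (f * g) ≤ content D f * content D g :=
  content_le.mpr fun n => by
    rw [coeff_mul]
    exact Submodule.sum_mem _ fun p _ =>
      Submodule.mul_mem_mul (coeff_mem_content f _) (coeff_mem_content g _)

theorem algebraMap_ne_zero_of_notMem [IsFractionRing D K] {P : PrimeSpectrum D}
    {s : D} (hs : s ∉ P.asIdeal) : algebraMap D K s ≠ 0 := by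
  rw [Ne, FaithfulSMul.algebraMap_eq_zero_iff]
  rintro rfl
  exact hs P.asIdeal.zero_mem

end Content

/-! ### Extension to `D_P` and local tests for spectral operations -/

section Localization

variable {D : Type*} [CommRing D] [IsDomain D] {K : Type*} [Field K] [Algebra D K]
  [IsFractionRing D K] {P : PrimeSpectrum D}

theorem mem_localizationAt_iff {x : K} :
    x ∈ localizationAt K P ↔ ∃ s ∉ P.asIdeal, ∃ a : D, algebraMap D K a = s • x := by
  change (∃ (a s : D) (_ : s ∈ P.asIdeal.primeCompl),
    x = algebraMap D K a * (algebraMap D K s)⁻¹) ↔ _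
  constructor
  · rintro ⟨a, s, hs, rfl⟩
    refine ⟨s, hs, a, ?_⟩
    have := algebraMap_ne_zero_of_notMem (K := K) (P := P) hs
    rw [Algebra.smul_def]
    field_simp
  · rintro ⟨s, hs, a, h⟩
    refine ⟨a, s, hs, ?_⟩
    have := algebraMap_ne_zero_of_notMem (K := K) (P := P) hs
    rw [h, Algebra.smul_def]
    field_simp

theorem one_mem_localizationAt : (1 : K) ∈ localizationAt K P :=
  mem_localizationAt_iff.mpr ⟨1, fun h => P.isPrime.ne_top ((Ideal.eq_top_iff_one _).mpr h), 1,
    by simp⟩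

theorem mul_mem_localizationAt {x y : K} (hx : x ∈ localizationAt K P)
    (hy : y ∈ localizationAt K P) : x * y ∈ localizationAt K P :=
  (Localization.subalgebra.ofField K P.asIdeal.primeCompl
    P.asIdeal.primeCompl_le_nonZeroDivisors).mul_mem hx hy

theorem localizationAt_mul_self : localizationAt K P * localizationAt K P ≤ localizationAt K P :=
  Submodule.mul_le.mpr fun _ hx _ hy => mul_mem_localizationAt hx hy

theorem le_mul_localizationAt (E : Submodule D K) : E ≤ E * localizationAt K P := fun x hx => by
  simpa using Submodule.mul_mem_mul hx (one_mem_localizationAt (P := P))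

theorem mul_localizationAt_le {E F : Submodule D K} (h : E ≤ F * localizationAt K P) :
    E * localizationAt K P ≤ F * localizationAt K P := by
  refine (mul_le_mul_left h _).trans ?_
  rw [mul_assoc]
  exact mul_le_mul_right localizationAt_mul_self _

/-- Only finitely many denominators occur in `x`, and their product avoids the prime `P`. -/
theorem exists_smul_mem_of_mem_mul_localizationAt {E : Submodule D K} {x : K}
    (hx : x ∈ E * localizationAt K P) : ∃ s ∉ P.asIdeal, s • x ∈ E := by
  induction hx using Submodule.mul_induction_on' with
  | mem_mul_mem m hm n hn =>
    obtain ⟨s, hs, a, ha⟩ := mem_localizationAt_iff.mp hn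
    refine ⟨s, hs, ?_⟩
    rw [← mul_smul_comm, ← ha, mul_comm, ← Algebra.smul_def]
    exact E.smul_mem _ hm
  | add x _ y _ hx hy =>
    obtain ⟨s, hs, hx⟩ := hx
    obtain ⟨t, ht, hy⟩ := hy
    refine ⟨s * t, fun h => (P.isPrime.mem_or_mem h).elim hs ht, ?_⟩
    rw [smul_add]
    refine E.add_mem ?_ ?_
    · rw [mul_comm, mul_smul]
      exact E.smul_mem _ hx
    · rw [mul_smul]
      exact E.smul_mem _ hy

theorem le_spectral (Δ : Set (PrimeSpectrum D)) (E : Submodule D K) : E ≤ spectral Δ E :=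
  le_iInf₂ fun _ _ => le_mul_localizationAt E

/-- The closure lies between `E` and each `E D_P`, and extending to `D_P` twice gives nothing new;
so closures agree exactly when all the local extensions do. -/
theorem spectral_eq_iff {Δ : Set (PrimeSpectrum D)} {E F : Submodule D K} :
    spectral Δ E = spectral Δ F ↔
      ∀ P ∈ Δ, E ≤ F * localizationAt K P ∧ F ≤ E * localizationAt K P := by
  refine ⟨fun h P hP => ⟨?_, ?_⟩, fun h => ?_⟩
  · exact (le_spectral Δ E).trans (h.le.trans (iInf₂_le P hP))
  · exact (le_spectral Δ F).trans (h.ge.trans (iInf₂_le P hP))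
  · exact iInf_congr fun P => iInf_congr fun hP =>
      le_antisymm (mul_localizationAt_le (h P hP).1) (mul_localizationAt_le (h P hP).2)

variable (K P) in
/-- The localization `D_P` is a valuation ring of `K`. -/
def IsValuationAt : Prop :=
  ∀ x : K, x ∈ localizationAt K P ∨ x⁻¹ ∈ localizationAt K P

/-- The localization `D_P` as a valuation subring of `K`. -/
noncomputable def IsValuationAt.valuationSubring (h : IsValuationAt K P) : ValuationSubring K where
  __ := (Localization.subalgebra.ofField K P.asIdeal.primeCompl
    P.asIdeal.primeCompl_le_nonZeroDivisors).toSubring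
  mem_or_inv_mem' := h

end Localization

/-! ### Gauss' lemma for valuations -/

/-- The first coefficient at which the valuation of the coefficients of `f` is maximal. -/
theorem exists_first_max_coeff {K Γ : Type*} [Field K] [LinearOrderedCommGroupWithZero Γ]
    (v : Valuation K Γ) {f : K[X]} (hf : f ≠ 0) :
    ∃ i, f.coeff i ≠ 0 ∧ (∀ k, v (f.coeff k) ≤ v (f.coeff i)) ∧
      ∀ k < i, v (f.coeff k) < v (f.coeff i) := by
  classical
  have hex : ∃ i, f.coeff i ≠ 0 ∧ ∀ k, v (f.coeff k) ≤ v (f.coeff i) := by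
    obtain ⟨i, hi, hmax⟩ := f.support.exists_max_image (fun i => v (f.coeff i))
      (Polynomial.support_nonempty.mpr hf)
    refine ⟨i, mem_support_iff.mp hi, fun k => ?_⟩
    by_cases hk : f.coeff k = 0
    · simp [hk]
    · exact hmax k (mem_support_iff.mpr hk)
  obtain ⟨h0, h1⟩ := Nat.find_spec hex
  refine ⟨Nat.find hex, h0, h1, fun k hk => lt_of_not_ge fun hle => Nat.find_min hex hk ?_⟩
  exact ⟨fun h => h0 (by simpa [h] using hle), fun j => (h1 j).trans hle⟩

/-- A single index `n` serves all pairs `i, j`, so over a valuation ring the one coefficient `(f *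
g).coeff n` generates everything in `c(f)c(g)`. -/
theorem exists_forall_valuation_coeff_mul_le {K Γ : Type*} [Field K]
    [LinearOrderedCommGroupWithZero Γ] (v : Valuation K Γ) {f g : K[X]} (hf : f ≠ 0) (hg : g ≠ 0) :
    ∃ n, ∀ i j, v (f.coeff i * g.coeff j) ≤ v ((f * g).coeff n) := by
  classical
  obtain ⟨i, hi0, hi, hi'⟩ := exists_first_max_coeff v hf
  obtain ⟨j, hj0, hj, hj'⟩ := exists_first_max_coeff v hg
  have hne : v (f.coeff i * g.coeff j) ≠ 0 := by simp [hi0, hj0]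
  -- Any other term of this coefficient has its first index below `i` or its second below `j`, hence
  -- strictly smaller value by the choice of first maxima.
  have key : v ((f * g).coeff (i + j)) = v (f.coeff i * g.coeff j) := by
    rw [coeff_mul, ← Finset.add_sum_erase _ _
      (show (i, j) ∈ Finset.HasAntidiagonal.antidiagonal (i + j) by simp)]
    refine v.map_add_eq_of_lt_left (v.map_sum_lt hne ?_)
    rintro ⟨k, l⟩ hkl
    obtain ⟨hne', hsum⟩ := Finset.mem_erase.mp hkl
    have hsum : k + l = i + j := Finset.HasAntidiagonal.mem_antidiagonal.mp hsum
    rw [map_mul, map_mul]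
    have hvi : 0 < v (f.coeff i) := by simpa [zero_lt_iff] using hi0
    have hvj : 0 < v (g.coeff j) := by simpa [zero_lt_iff] using hj0
    rcases lt_or_ge k i with hk | hk
    · calc v (f.coeff k) * v (g.coeff l) ≤ v (f.coeff k) * v (g.coeff j) := by gcongr; exact hj l
        _ < v (f.coeff i) * v (g.coeff j) := mul_lt_mul_of_pos_right (hi' k hk) hvj
    · have hl : l < j := by
        rcases hk.eq_or_lt with rfl | hk
        · exact absurd (by simp; omega) hne'
        · omega
      calc v (f.coeff k) * v (g.coeff l) ≤ v (f.coeff i) * v (g.coeff l) := by gcongr; exact hi k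
        _ < v (f.coeff i) * v (g.coeff j) := mul_lt_mul_of_pos_left (hj' l hl) hvi
  refine ⟨i + j, fun k l => ?_⟩
  rw [key, map_mul, map_mul]
  exact mul_le_mul' (hi k) (hj l)

/-! ### Multiplicativity of contents and valuation rings -/

section Valuation

variable {D : Type*} [CommRing D] [IsDomain D] {K : Type*} [Field K] [Algebra D K]
  [IsFractionRing D K] {P : PrimeSpectrum D}

/-- Gauss' lemma over the valuation ring `D_P`. -/
theorem IsValuationAt.content_mul_content_le (h : IsValuationAt K P) {f g : K[X]} (hf : f ≠ 0)
    (hg : g ≠ 0) : content D f * content D g ≤ content D (f * g) * localizationAt K P := by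
  obtain ⟨n, hn⟩ := exists_forall_valuation_coeff_mul_le h.valuationSubring.valuation hf hg
  rw [content, content, Submodule.span_mul_span, Submodule.span_le]
  rintro _ ⟨_, ⟨i, rfl⟩, _, ⟨j, rfl⟩, rfl⟩
  obtain ⟨a, ha⟩ := (h.valuationSubring.valuation_le_iff _ _).mp (hn i j)
  change f.coeff i * g.coeff j ∈ _
  rw [← ha, mul_comm (a : K)]
  exact Submodule.mul_mem_mul (coeff_mem_content _ n) a.2

/-- If contents are multiplicative over `D_P`, then `D_P` contains every `x` with
`x * (1 - x) ∈ D_P`. -/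
theorem mem_localizationAt_of_mul_one_sub_mem
    (h : ∀ f g : K[X], f ≠ 0 → g ≠ 0 →
      content D f * content D g ≤ content D (f * g) * localizationAt K P)
    {x : K} (hx : x * (1 - x) ∈ localizationAt K P) : x ∈ localizationAt K P := by
  have hle : content D ((X - C x) * (X - C (1 - x))) ≤ localizationAt K P := by
    have he : (X - C x) * (X - C (1 - x)) = X ^ 2 - X + C (x * (1 - x)) := by
      simp only [C_mul, C_sub, C_1]
      ring
    have h1 := one_mem_localizationAt (K := K) (P := P)
    refine content_le.mpr fun n => ?_
    rw [he, coeff_add, coeff_sub, coeff_X_pow, coeff_X, coeff_C]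
    refine Submodule.add_mem _ (Submodule.sub_mem _ ?_ ?_) ?_ <;> split_ifs <;> simp [h1, hx]
  -- The constant coefficient `-x` times the leading coefficient `1`.
  have hmem := h (X - C x) (X - C (1 - x)) (X_sub_C_ne_zero _) (X_sub_C_ne_zero _)
    (Submodule.mul_mem_mul (coeff_mem_content _ 0) (coeff_mem_content _ 1))
  have := localizationAt_mul_self ((mul_le_mul_left hle _) hmem)
  simpa [coeff_X, coeff_C, coeff_one] using this

/-- If contents are multiplicative over `D_P`, then `D_P` is a valuation ring. -/
theorem isValuationAt_of_content_mul_content_le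
    (h : ∀ f g : K[X], f ≠ 0 → g ≠ 0 →
      content D f * content D g ≤ content D (f * g) * localizationAt K P) :
    IsValuationAt K P := by
  intro x
  by_cases hx0 : x = 0
  · exact Or.inl (hx0 ▸ Submodule.zero_mem _)
  have hf : C x * X + C 1 ≠ 0 := fun h0 => by simpa using congr_arg (coeff · 0) h0
  have hg : C x * X - C 1 ≠ 0 := fun h0 => by simpa using congr_arg (coeff · 0) h0
  -- The linear term cancels in the product, while `x` is still a product of coefficients of the
  -- factors.
  have hle : content D ((C x * X + C 1) * (C x * X - C 1)) ≤ Submodule.span D {x ^ 2, 1} := by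
    have he : (C x * X + C 1) * (C x * X - C 1) = C (x ^ 2) * X ^ 2 - C 1 := by
      simp only [C_pow, C_1]
      ring
    have h2 : x ^ 2 ∈ Submodule.span D {x ^ 2, 1} := Submodule.subset_span (by simp)
    have h1 : (1 : K) ∈ Submodule.span D {x ^ 2, 1} := Submodule.subset_span (by simp)
    refine content_le.mpr fun n => ?_
    rw [he, coeff_sub, coeff_C_mul, coeff_X_pow, coeff_C]
    refine Submodule.sub_mem _ ?_ ?_ <;> split_ifs <;> simp [h1, h2]
  have hmem := h _ _ hf hg
    (Submodule.mul_mem_mul (coeff_mem_content _ 1) (coeff_mem_content _ 0))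
  have hmem := (mul_le_mul_left hle _) hmem
  obtain ⟨s, hs, hsx⟩ := exists_smul_mem_of_mem_mul_localizationAt hmem
  have hsx : s • x ∈ Submodule.span D {x ^ 2, 1} := by
    simpa [coeff_one, coeff_X] using hsx
  obtain ⟨r, t, hrt⟩ := Submodule.mem_span_pair.mp hsx
  simp only [Algebra.smul_def] at hrt
  have hs0 := algebraMap_ne_zero_of_notMem (K := K) (P := P) hs
  -- From `s x = r x² + t`, the element `y = r x / s` satisfies `y (1 - y) = r t / s²`.
  have hy : algebraMap D K r * x / algebraMap D K s ∈ localizationAt K P := by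
    refine mem_localizationAt_of_mul_one_sub_mem h (mem_localizationAt_iff.mpr
      ⟨s * s, fun h => (P.isPrime.mem_or_mem h).elim hs hs, r * t, ?_⟩)
    rw [Algebra.smul_def, map_mul, map_mul]
    field_simp
    linear_combination algebraMap D K r * hrt
  obtain ⟨u, hu, d, hd⟩ := mem_localizationAt_iff.mp hy
  rw [Algebra.smul_def] at hd
  have hd : algebraMap D K d * algebraMap D K s = algebraMap D K u * algebraMap D K r * x := by
    rw [hd]
    field_simp
  -- Here `y = d / u`. If `d ∈ P`, then `1 - y` is a unit and `x = t / (s (1 - y))`; otherwise `y`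
  -- is a unit and `x⁻¹ = r / (s y)`.
  by_cases hdP : d ∈ P.asIdeal
  · left
    refine mem_localizationAt_iff.mpr ⟨s * (u - d), fun hm => ?_, u * t, ?_⟩
    · rcases P.isPrime.mem_or_mem hm with hm | hm
      · exact hs hm
      · exact hu (by simpa using P.asIdeal.add_mem hm hdP)
    · simp only [Algebra.smul_def, map_mul, map_sub]
      linear_combination algebraMap D K u * hrt + x * hd
  · right
    refine mem_localizationAt_iff.mpr ⟨d * s,
      fun hm => (P.isPrime.mem_or_mem hm).elim hdP hs, u * r, ?_⟩
    rw [Algebra.smul_def, map_mul, map_mul, hd]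
    field_simp

end Valuation

/-! ### Existence of maximal `t`-ideals -/

section TOperation

variable {D : Type*} [CommRing D] {K : Type*} [Field K] [Algebra D K]

theorem coeSubmodule_ne_bot [IsDomain D] [IsFractionRing D K] {I : Ideal D} (hI : I ≠ ⊥) :
    IsLocalization.coeSubmodule K I ≠ ⊥ := by
  obtain ⟨x, hx, hx0⟩ := Submodule.exists_mem_ne_zero_of_ne_bot hI
  refine (Submodule.ne_bot_iff _).mpr ⟨algebraMap D K x, ⟨x, hx, rfl⟩, ?_⟩
  simpa using hx0

theorem tOp_le_tOp {E F : Submodule D K} (hF : F ≠ ⊥) (h : E ≤ tOp F) : tOp E ≤ tOp F :=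
  (tOp_mono h).trans (tOp_tOp hF).le

theorem coeSubmodule_comap_tOp_le (E : Submodule D K) :
    IsLocalization.coeSubmodule K ((tOp E).comap (Algebra.linearMap D K)) ≤ tOp E :=
  Submodule.map_comap_le _ _

theorem le_comap_tOp (I : Ideal D) :
    I ≤ (tOp (IsLocalization.coeSubmodule K I)).comap (Algebra.linearMap D K) :=
  Submodule.map_le_iff_le_comap.mp (le_tOp _)

theorem one_le_iff_one_mem {E : Submodule D K} : 1 ≤ E ↔ (1 : K) ∈ E := by
  rw [Submodule.one_eq_span, Submodule.span_singleton_le_iff_mem]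

theorem isQuasiIdeal_comap_tOp {E : Submodule D K} (hE : E ≠ ⊥)
    (h : (tOp E).comap (Algebra.linearMap D K) ≠ ⊥) :
    IsQuasiIdeal (tOp : Submodule D K → Submodule D K)
      ((tOp E).comap (Algebra.linearMap D K)) :=
  ⟨h, le_antisymm (Submodule.comap_mono (tOp_le_tOp hE (coeSubmodule_comap_tOp_le E)))
    (le_comap_tOp _)⟩

variable [IsDomain D] [IsFractionRing D K]

/-- The supremum of a nonempty chain of quasi-`t`-ideals is a quasi-`t`-ideal. -/
theorem isQuasiIdeal_sSup_of_isChain {c : Set (Ideal D)} (hc : IsChain (· ≤ ·) c)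
    (hne : c.Nonempty)
    (h : ∀ I ∈ c, IsQuasiIdeal (tOp : Submodule D K → Submodule D K) I) :
    IsQuasiIdeal (tOp : Submodule D K → Submodule D K) (sSup c) := by
  obtain ⟨I, hI⟩ := hne
  have h0 : sSup c ≠ ⊥ := fun h0 => (h I hI).1 (le_bot_iff.mp (h0 ▸ le_sSup hI))
  refine ⟨h0, le_antisymm (fun x hx => ?_) (le_comap_tOp _)⟩
  obtain ⟨F, hF, hF0, hFle, hxF⟩ :=
    (mem_finType_iff vOp_mono (coeSubmodule_ne_bot h0)).mp hx
  -- Finite type enters here: the witness `F` comes from a finitely generated ideal, which by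
  -- compactness already lies in one member of the chain.
  obtain ⟨G, hG, rfl⟩ : ∃ G : Ideal D, G ≤ sSup c ∧ Submodule.map (Algebra.linearMap D K) G = F :=
    ⟨Submodule.comap (Algebra.linearMap D K) F,
      (Submodule.comap_mono hFle).trans
        (Submodule.comap_map_eq_of_injective (IsFractionRing.injective D K) _).le,
      Submodule.map_comap_eq_self (hFle.trans (LinearMap.map_le_range))⟩
  have hGfg : G.FG := Submodule.fg_of_fg_map_injective _ (IsFractionRing.injective D K) hF
  obtain ⟨J, hJ, hGJ⟩ := (CompleteLattice.isCompactElement_iff_le_of_directed_sSup_le _ _).mp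
    ((Submodule.fg_iff_compact G).mp hGfg) c ⟨I, hI⟩ hc.directedOn hG
  refine le_sSup hJ ?_
  rw [← (h J hJ).2]
  exact (mem_finType_iff vOp_mono (coeSubmodule_ne_bot (h J hJ).1)).mpr
    ⟨_, hF, hF0, Submodule.map_mono hGJ, hxF⟩

/-- Every proper quasi-`t`-ideal lies in a quasi-`t`-maximal ideal. -/
theorem exists_le_isQuasiMaximal_tOp {I : Ideal D} (hI : I ≠ ⊤)
    (h : IsQuasiIdeal (tOp : Submodule D K → Submodule D K) I) :
    ∃ M : Ideal D, I ≤ M ∧ IsQuasiMaximal (tOp : Submodule D K → Submodule D K) M := by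
  refine zorn_le_nonempty₀
    {I : Ideal D | I ≠ ⊤ ∧ IsQuasiIdeal (tOp : Submodule D K → Submodule D K) I}
    (fun c hc hchain J hJ => ⟨sSup c, ⟨fun htop => ?_, ?_⟩, fun _ => le_sSup⟩) I ⟨hI, h⟩
  · have h1 : (1 : D) ∈ sSup c := htop ▸ Submodule.mem_top
    obtain ⟨L, hL, h1L⟩ := (Submodule.mem_sSup_of_directed ⟨J, hJ⟩ hchain.directedOn).mp h1
    exact (hc hL).1 ((Ideal.eq_top_iff_one L).mpr h1L)
  · exact isQuasiIdeal_sSup_of_isChain hchain ⟨J, hJ⟩ fun L hL => (hc hL).2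

/-- Otherwise the trace of `E^t` on `D` is a proper quasi-`t`-ideal, and a maximal `t`-ideal above
it contains `E`. -/
theorem tOp_eq_tOp_one {E : Submodule D K} (hE : E ≠ ⊥) (hE1 : E ≤ 1)
    (h : ∀ P ∈ quasiMax (tOp : Submodule D K → Submodule D K),
      ¬ E ≤ IsLocalization.coeSubmodule K P.asIdeal) : tOp E = tOp 1 := by
  refine le_antisymm (tOp_mono hE1) (tOp_le_tOp hE (one_le_iff_one_mem.mpr ?_))
  by_contra h1
  have hEI : E = IsLocalization.coeSubmodule K (E.comap (Algebra.linearMap D K)) :=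
    (Submodule.map_comap_eq_self (by rwa [← Submodule.one_eq_range])).symm
  have hle : E ≤
      IsLocalization.coeSubmodule K ((tOp E).comap (Algebra.linearMap D K)) := by
    conv_lhs => rw [hEI]
    exact Submodule.map_mono (Submodule.comap_mono (le_tOp E))
  obtain ⟨M, hM, hmax⟩ := exists_le_isQuasiMaximal_tOp
    (I := (tOp E).comap (Algebra.linearMap D K)) (K := K)
    (fun htop => h1 (by simpa using (htop ▸ Submodule.mem_top :
      (1 : D) ∈ (tOp E).comap (Algebra.linearMap D K))))
    (isQuasiIdeal_comap_tOp hE fun h0 => hE (le_bot_iff.mp (hle.trans (by simp [h0]))))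
  exact h ⟨M, hmax.isPrime⟩ hmax (hle.trans (Submodule.map_mono hM))

end TOperation

/-! ### P`v`MDs and valuation rings at maximal `t`-ideals -/

section Prufer

variable {D : Type*} [CommRing D] [IsDomain D] {K : Type*} [Field K] [Algebra D K]
  [IsFractionRing D K] {P : PrimeSpectrum D}

/-- The localization of a P`v`MD at a maximal `t`-ideal is a valuation ring. -/
theorem IsPruferMultiplicationDomain.isValuationAt
    (h : IsPruferMultiplicationDomain (vOp : Submodule D K → Submodule D K))
    (hP : P ∈ quasiMax (tOp : Submodule D K → Submodule D K)) : IsValuationAt K P := by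
  intro x
  obtain ⟨a, b, hb, rfl⟩ := IsFractionRing.div_surjective D x
  have hb0 : b ≠ 0 := nonZeroDivisors.ne_zero hb
  by_cases ha0 : a = 0
  · simp [ha0]
  have hI0 : Ideal.span {a, b} ≠ ⊥ := fun h0 =>
    hb0 ((Submodule.eq_bot_iff _).mp h0 b (Ideal.subset_span (by simp)))
  have hinv := h (Ideal.span {a, b}) hI0 (Submodule.fg_span (by simp))
  have hnle : ¬ IsLocalization.coeSubmodule K (Ideal.span {a, b}) *
      (1 / IsLocalization.coeSubmodule K (Ideal.span {a, b})) ≤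
      IsLocalization.coeSubmodule K P.asIdeal := by
    intro hle
    have h1 : (1 : K) ∈ tOp (IsLocalization.coeSubmodule K P.asIdeal) :=
      tOp_mono hle (hinv.ge (le_tOp 1 (one_le_iff_one_mem.mp le_rfl)))
    refine P.isPrime.ne_top ((Ideal.eq_top_iff_one _).mpr ?_)
    rw [← (show IsQuasiMaximal tOp P.asIdeal from hP).prop.2.2]
    simpa using h1
  -- Some product `i z` lies outside `P`. As `i` is a combination of `a` and `b`, one of `a z`, `b
  -- z` in `D` lies outside `P`, and it serves as denominator for `a / b` or its inverse.
  have hex : ∃ z ∈ 1 / IsLocalization.coeSubmodule K (Ideal.span {a, b}), ∃ i ∈ Ideal.span {a, b},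
      ∀ d ∈ P.asIdeal, algebraMap D K d ≠ algebraMap D K i * z := by
    by_contra! hcon
    refine hnle (Submodule.mul_le.mpr ?_)
    rintro _ ⟨i, hi, rfl⟩ z hz
    obtain ⟨d, hd, he⟩ := hcon z hz i hi
    exact ⟨d, hd, he⟩
  obtain ⟨z, hz, i, hi, hiz⟩ := hex
  rw [Submodule.mem_div_iff_forall_mul_mem] at hz
  obtain ⟨a', ha'⟩ := Submodule.mem_one.mp (hz (algebraMap D K a)
    ⟨a, Ideal.subset_span (by simp), rfl⟩)
  obtain ⟨b', hb'⟩ := Submodule.mem_one.mp (hz (algebraMap D K b)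
    ⟨b, Ideal.subset_span (by simp), rfl⟩)
  have haK : algebraMap D K a ≠ 0 := by simpa using ha0
  have hbK : algebraMap D K b ≠ 0 := by simpa using hb0
  by_cases haP : a' ∈ P.asIdeal
  · have hbP : b' ∉ P.asIdeal := by
      intro hbP
      obtain ⟨r, s, rfl⟩ := Ideal.mem_span_pair.mp hi
      refine hiz (r * a' + s * b') (P.asIdeal.add_mem (P.asIdeal.mul_mem_left _ haP)
        (P.asIdeal.mul_mem_left _ hbP)) ?_
      simp only [map_add, map_mul, ha', hb']
      ring
    refine Or.inl (mem_localizationAt_iff.mpr ⟨b', hbP, a', ?_⟩)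
    rw [Algebra.smul_def, ha', hb']
    field_simp
  · refine Or.inr (mem_localizationAt_iff.mpr ⟨a', haP, b', ?_⟩)
    rw [Algebra.smul_def, ha', hb']
    field_simp

/-- Clearing denominators turns comparability in `D_P` into divisibility in `D`. -/
theorem IsValuationAt.dvd_or_dvd (h : IsValuationAt K P) (a b : D) :
    ∃ t ∉ P.asIdeal, a ∣ t * b ∨ b ∣ t * a := by
  have h1 : (1 : D) ∉ P.asIdeal := fun h => P.isPrime.ne_top ((Ideal.eq_top_iff_one _).mpr h)
  by_cases ha : a = 0
  · exact ⟨1, h1, Or.inr (by simp [ha])⟩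
  by_cases hb : b = 0
  · exact ⟨1, h1, Or.inl (by simp [hb])⟩
  have haK : algebraMap D K a ≠ 0 := by simpa using ha
  have hbK : algebraMap D K b ≠ 0 := by simpa using hb
  have hinj := IsFractionRing.injective D K
  rcases h (algebraMap D K a / algebraMap D K b) with hx | hx <;>
    obtain ⟨t, ht, c, hc⟩ := mem_localizationAt_iff.mp hx <;>
    rw [Algebra.smul_def] at hc
  · refine ⟨t, ht, Or.inr ⟨c, hinj ?_⟩⟩
    rw [map_mul, map_mul, hc]
    field_simp
  · refine ⟨t, ht, Or.inl ⟨c, hinj ?_⟩⟩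
    rw [map_mul, map_mul, hc]
    field_simp

/-- A finitely generated ideal becomes principal in a valuation ring `D_P`. -/
theorem IsValuationAt.exists_dvd_of_fg (h : IsValuationAt K P) {I : Ideal D} (hI : I.FG) :
    ∃ a ∈ I, ∃ s ∉ P.asIdeal, ∀ x ∈ I, a ∣ s * x := by
  have hmul : ∀ {s t : D}, s ∉ P.asIdeal → t ∉ P.asIdeal → s * t ∉ P.asIdeal :=
    fun hs ht hst => (P.isPrime.mem_or_mem hst).elim hs ht
  induction I, hI using Submodule.fg_induction with
  | singleton a =>
    refine ⟨a, Submodule.mem_span_singleton_self a, 1,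
      fun h => P.isPrime.ne_top ((Ideal.eq_top_iff_one _).mpr h), fun x hx => ?_⟩
    simpa using Ideal.mem_span_singleton.mp hx
  | sup I J hI hJ ihI ihJ =>
    obtain ⟨a, ha, s, hs, hsa⟩ := ihI
    obtain ⟨b, hb, t, ht, htb⟩ := ihJ
    obtain ⟨u, hu, hab | hab⟩ := h.dvd_or_dvd a b
    · refine ⟨a, Submodule.mem_sup_left ha, s * (t * u), hmul hs (hmul ht hu), fun x hx => ?_⟩
      obtain ⟨y, hy, z, hz, rfl⟩ := Submodule.mem_sup.mp hx
      have h1 : a ∣ t * u * (s * y) := (hsa y hy).mul_left _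
      have h2 : a ∣ s * (u * (t * z)) := (hab.trans (mul_dvd_mul_left u (htb z hz))).mul_left _
      convert dvd_add h1 h2 using 1
      ring
    · refine ⟨b, Submodule.mem_sup_right hb, s * (t * u), hmul hs (hmul ht hu), fun x hx => ?_⟩
      obtain ⟨y, hy, z, hz, rfl⟩ := Submodule.mem_sup.mp hx
      have h1 : b ∣ t * (u * (s * y)) := (hab.trans (mul_dvd_mul_left u (hsa y hy))).mul_left _
      have h2 : b ∣ s * u * (t * z) := (htb z hz).mul_left _
      convert dvd_add h1 h2 using 1
      ring

/-- If `D_P` is a valuation ring for all maximal `t`-ideals `P`, then `D` is a P`v`MD. -/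
theorem isPruferMultiplicationDomain_of_isValuationAt
    (h : ∀ P ∈ quasiMax (tOp : Submodule D K → Submodule D K), IsValuationAt K P) :
    IsPruferMultiplicationDomain (vOp : Submodule D K → Submodule D K) := by
  intro I hI0 hI
  obtain ⟨y, hy, hy0⟩ := Submodule.exists_mem_ne_zero_of_ne_bot hI0
  refine tOp_eq_tOp_one ?_ Submodule.mul_one_div_le_one fun P hP hle => ?_
  · have h1 : (1 : K) ∈ 1 / IsLocalization.coeSubmodule K I := by
      rw [Submodule.mem_div_iff_forall_mul_mem]
      rintro _ ⟨x, -, rfl⟩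
      exact Submodule.mem_one.mpr ⟨x, by simp⟩
    refine fun h0 => coeSubmodule_ne_bot (K := K) hI0 (le_bot_iff.mp (h0 ▸ fun x hx => ?_))
    simpa using Submodule.mul_mem_mul hx h1
  · obtain ⟨a, ha, s, hs, hsa⟩ := (h P hP).exists_dvd_of_fg hI
    have ha0 : a ≠ 0 := by
      rintro rfl
      rcases mul_eq_zero.mp (zero_dvd_iff.mp (hsa y hy)) with rfl | h0
      · exact hs P.asIdeal.zero_mem
      · exact hy0 h0
    have haK : algebraMap D K a ≠ 0 := by simpa using ha0
    -- Locally `I` is generated by `a`, with `s` clearing denominators; so `s / a` is in the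
    -- inverse, and multiplying by `a` puts `s ∉ P` into `I I⁻¹`.
    have hz : algebraMap D K s / algebraMap D K a ∈ 1 / IsLocalization.coeSubmodule K I := by
      rw [Submodule.mem_div_iff_forall_mul_mem]
      rintro _ ⟨x, hx, rfl⟩
      obtain ⟨c, hc⟩ := hsa x hx
      refine Submodule.mem_one.mpr ⟨c, ?_⟩
      have := congr_arg (algebraMap D K) hc
      rw [map_mul, map_mul] at this
      rw [Algebra.linearMap_apply, div_mul_eq_mul_div, this]
      field_simp
    obtain ⟨d, hd, hds⟩ := hle (Submodule.mul_mem_mul ⟨a, ha, rfl⟩ hz)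
    rw [Algebra.linearMap_apply, Algebra.linearMap_apply, mul_div_cancel₀ _ haK] at hds
    exact hs (IsFractionRing.injective D K hds ▸ hd)

end Prufer

end Semistar

theorem corollary1p6 (D : Type*) [CommRing D] [IsDomain D]
    (K : Type*) [Field K] [Algebra D K] [IsFractionRing D K] :
    Semistar.IsPruferMultiplicationDomain
        (Semistar.vOp : Submodule D K → Submodule D K) ↔
      ∀ f g : Polynomial K, f ≠ 0 → g ≠ 0 →
        Semistar.wOp (Semistar.content D (f * g)) =
          Semistar.wOp (Semistar.content D f * Semistar.content D g) := by
  constructor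
  · intro h f g hf hg
    refine Semistar.spectral_eq_iff.mpr fun P hP => ⟨?_, ?_⟩
    · exact (Semistar.content_mul_le f g).trans (Semistar.le_mul_localizationAt _)
    · exact (h.isValuationAt hP).content_mul_content_le hf hg
  · intro h
    refine Semistar.isPruferMultiplicationDomain_of_isValuationAt fun P hP => ?_
    exact Semistar.isValuationAt_of_content_mul_content_le fun f g hf hg =>
      (Semistar.spectral_eq_iff.mp (h f g hf hg) P hP).2
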